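/- Let $\mathbb{F}_q$ be a finite field and let $1\le k\le n$, $f\ge 1$, $g\ge 1$ be integers. Let $\alpha_1,\dots,\alpha_n\in\mathbb{F}_q$ be distinct and let $\gamma_1,\dots,\gamma_k\in\mathbb{F}_q$ be distinct (the two lists may overlap). Put $$M(f,g)=\binom{g+f}{g}-1,\qquad \mu(f,g)=\frac{q^{M(f,g)}-1}{q-1},\qquad \tilde k=g(k-1)+1 .$$ Storage. There are $f$ messages $W^{(1)},\dots,W^{(f)}$, each a $\beta\times k$ matrix over $\mathbb{F}_q$, all of whose symbols are independent and uniform; let $L=\beta k$. Each row of each message is encoded by the $[n,k]$ Reed–Solomon code with Lagrange encoding, that is, with the generator matrix $(\iota_i(\alpha_j))_{i\in[k],j\in[n]}$, where $\iota_i(z)=\prod_{t\ne i}\frac{z-\gamma_t}{\gamma_i-\gamma_t}$, and the $j$-th symbol of each codeword is stored on database $j$, $j\in[n]$. Candidates. Let $\mu\in[f:\mu(f,g)]$ and let $\phi^{(1)},\dots,\phi^{(\mu)}\in\mathbb{F}_q[x_1,\dots,x_f]$ be polynomials of degree at most $g$ that include the $f$ messages, i.e. each $x_m$, $m\in[f]$,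 is one of them. Let $X^{(v)}$ be the $L$-tuple of values of $\phi^{(v)}$ on the messages, entry by entry, and let $\mathrm{H}_{\min}$ be the minimum over $v$ of the entropy, in $q$-ary units, of $\phi^{(v)}$ at a uniformly random point of $\mathbb{F}_q^f$. Schemes. For a desired index $v$ the user sends database $j$ a query $Q^{(v)}_j$, where the queries are computed from private randomness independent of the messages, and database $j$ returns an answer $A^{(v)}_j$ that is a deterministic function of $Q^{(v)}_j$ and of the data stored on it. The scheme must be private, i.e. $(Q^{(v)}_j,A^{(v)}_j,X^{(1)},\dots,X^{(\mu)})$ and $(Q^{(v')}_j,A^{(v')}_j,X^{(1)},\dots,X^{(\mu)})$ have the same distribution for all $v,v'\in[\mu]$ and all $j\in[n]$, and it must allow recovery, i.e. $H(X^{(v)}\mid A^{(v)}_1,\dots,A^{(v)}_n,Q^{(v)}_1,\dots,Q^{(v)}_n)=0$ for all $v\in[\mu]$. Its rate is $L\,\mathrm{H}_{\min}/D$, where $D$ is the total number of symbols of $\mathbb{F}_q$ in the $n$ answers. A rate is achievable if some such scheme, for some $\beta\ge 1$, has this rate. Theorem. The rate $$R=\begin{cases}\dfrac1f\,\mathrm{H}_{\min}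 & \text{if } n\le g(k-1)+1,\\[2ex] \dfrac{\frac{k}{\tilde k}\left(1-\frac{\tilde k}{n}\right)\mathrm{H}_{\min}}{1-\left(\frac{\tilde k}{n}\right)^{\min\{\mu,M(f,g)\}}-\left(\min\{\mu,M(f,g)\}-f\right)\left(1-\frac{\tilde k}{n}\right)\left(\frac{\tilde k}{n}\right)^{\mu-1}} & \text{otherwise}\end{cases}$$ is achievable. -/

import Mathlib

noncomputable section

/-! Entropies of finitely supported laws. -/

/-- Shannon entropy, in base `b`, of a random variable with law `p` on a finite alphabet
(`0 * logb b 0 = 0`). -/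
def entropy {α : Type*} [Fintype α] (b : ℝ) (p : PMF α) : ℝ :=
  -∑ a, (p a).toReal * Real.logb b (p a).toReal

/-- Conditional entropy `H(X | Y)`, in base `b`, where `p` is the joint law of `(X, Y)`:
`- ∑ p(x, y) log (p(x, y) / p(y))`; the terms with `p(x, y) = 0` vanish. -/
def condEntropy {α γ : Type*} [Fintype α] [Fintype γ] (b : ℝ) (p : PMF (α × γ)) : ℝ :=
  -∑ x, ∑ y, (p (x, y)).toReal *
    Real.logb b ((p (x, y)).toReal / ((p.map Prod.snd) y).toReal)

/-! Reed–Solomon storage with Lagrange encoding. -/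

/-- The generator matrix `(ι_i(α_j))` of the `[n, k]` Reed–Solomon code with evaluation points
`α_1, …, α_n`, where `ι_1, …, ι_k` is the Lagrange basis at the points `γ_1, …, γ_k`. -/
def lagrangeGenerator {F : Type*} [Field F] {n k : ℕ} (α : Fin n → F) (γ : Fin k → F) :
    Matrix (Fin k) (Fin n) F :=
  Matrix.of fun i j => (Lagrange.basis Finset.univ γ i).eval (α j)

/-- `f` messages, each a `β × k` matrix over `F`. -/
abbrev Messages (F : Type*) (f β k : ℕ) : Type _ := Fin f → Fin β → Fin k → F

/-- The data `C_j` stored on database `j`: every row of every message is encoded with the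
generator matrix `G`, and database `j` keeps the `j`-th symbol of each codeword. -/
def storedData {F : Type*} [Field F] {n k f β : ℕ} (G : Matrix (Fin k) (Fin n) F)
    (W : Messages F f β k) (j : Fin n) : Fin f → Fin β → F :=
  fun m i => Matrix.vecMul (W m i) G j

/-- The evaluation of a function `φ` of `f` variables on the messages, entry by entry: `L = β k`
symbols. -/
def functionEval {F : Type*} {f β k : ℕ} (φ : (Fin f → F) → F) (W : Messages F f β k) :
    Fin β → Fin k → F :=
  fun i l => φ fun m => W m i l

/-- The law of the messages: all symbols are independent and uniform on `F`. -/
def messageLaw (F : Type*) [Field F] [Fintype F] (f β k : ℕ) : PMF (Messages F f β k) :=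
  PMF.uniformOfFintype _

/-- The law of the prototype random variable of `φ`, i.e. of `φ` at a uniform point of `F^f`. -/
def prototypeLaw {F : Type*} [Field F] [Fintype F] {f : ℕ} (φ : (Fin f → F) → F) : PMF F :=
  (PMF.uniformOfFintype (Fin f → F)).map φ

/-- `H_min`: the minimal entropy, in `|F|`-ary units, of the prototypes of the candidates. -/
def minEntropy {F : Type*} [Field F] [Fintype F] {f μ : ℕ} (φ : Fin μ → (Fin f → F) → F) : ℝ :=
  ⨅ v, entropy (Fintype.card F) (prototypeLaw (φ v))

/-! Private computation protocols. -/

/-- The moves of the user and of the `n` databases when one out of `μ` candidate functions is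
to be computed on `f` messages with `β` rows. The user draws private randomness, independent of
the messages, and derives from it and from the desired index the query to each database.
Database `j` answers with `len j` symbols of `F`, a function of the query it receives and of the
data stored on it. -/
structure PCScheme (F : Type*) (n f μ β : ℕ) where
  /-- the user's private randomness -/
  Rand : Type
  [randFintype : Fintype Rand]
  /-- its law -/
  randLaw : PMF Rand
  /-- the query alphabet of each database -/
  Query : Fin n → Type
  [queryFintype : ∀ j, Fintype (Query j)]
  /-- the query to database `j` when the function with index `v` is desired -/
  query : Fin μ → Rand → ∀ j, Query j
  /-- number of symbols downloaded from database `j` -/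
  len : Fin n → ℕ
  /-- the answer of database `j` -/
  answer : ∀ j, Query j → (Fin f → Fin β → F) → (Fin (len j) → F)

attribute [instance] PCScheme.randFintype PCScheme.queryFintype

namespace PCScheme

variable {F : Type*} [Field F] [Fintype F] {n f μ β : ℕ} (S : PCScheme F n f μ β)

/-- The joint law of the user's randomness and the messages, which are independent. -/
def jointLaw (k : ℕ) : PMF (S.Rand × Messages F f β k) :=
  S.randLaw.bind fun r => (messageLaw F f β k).map fun W => (r, W)

/-- The answer of database `j` as a random variable, when `v` is the desired index. -/
def answerVar {k : ℕ} (G : Matrix (Fin k) (Fin n) F) (v : Fin μ)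
    (ω : S.Rand × Messages F f β k) (j : Fin n) : Fin (S.len j) → F :=
  S.answer j (S.query v ω.1 j) (storedData G ω.2 j)

/-- Privacy: for each database `j`, the joint law of its query, its answer and the evaluations of
all candidate functions does not depend on the desired index. -/
def IsPrivate {k : ℕ} (G : Matrix (Fin k) (Fin n) F) (φ : Fin μ → (Fin f → F) → F) : Prop :=
  ∀ (v v' : Fin μ) (j : Fin n),
    ((S.jointLaw k).map fun ω =>
      (S.query v ω.1 j, S.answerVar G v ω j, fun u => functionEval (φ u) ω.2)) =
    ((S.jointLaw k).map fun ω =>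
      (S.query v' ω.1 j, S.answerVar G v' ω j, fun u => functionEval (φ u) ω.2))

/-- Recovery: for each desired index `v`, the conditional entropy of the evaluation of the `v`-th
function, given all answers and all queries, is zero. -/
def IsRecoverable {k : ℕ} (G : Matrix (Fin k) (Fin n) F) (φ : Fin μ → (Fin f → F) → F) : Prop :=
  ∀ v : Fin μ,
    condEntropy (Fintype.card F)
      ((S.jointLaw k).map fun ω =>
        (functionEval (φ v) ω.2, (S.answerVar G v ω, S.query v ω.1))) = 0

/-- The total download cost in symbols of `F`. -/
def downloadCost {F : Type*} {n f μ β : ℕ} (S : PCScheme F n f μ β) : ℕ := ∑ j, S.len j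

/-- The rate `L H_min / D`, with `L = β k`. -/
def rate (k : ℕ) (φ : Fin μ → (Fin f → F) → F) : ℝ :=
  ((β * k : ℕ) : ℝ) * minEntropy φ / (S.downloadCost : ℝ)

end PCScheme

/-- The rate `R` is achievable, for storage with generator matrix `G` and candidate functions `φ`:
for some positive number `β` of rows per message there is a private scheme that recovers the
desired function evaluation and has rate `R`. -/
def PCRateAchievable {F : Type*} [Field F] [Fintype F] {n k f μ : ℕ}
    (G : Matrix (Fin k) (Fin n) F) (φ : Fin μ → (Fin f → F) → F) (R : ℝ) : Prop :=
  ∃ β : ℕ, 0 < β ∧ ∃ S : PCScheme F n f μ β,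
    S.IsPrivate G φ ∧ S.IsRecoverable G φ ∧ S.rate k φ = R

/-! The numerical quantities in the rate. -/

/-- `M(m, g) = C(g + m, g) - 1`, the number of monomials of degree between `1` and `g` in `m`
variables. -/
def numMonomials (m g : ℕ) : ℕ := (g + m).choose g - 1

/-- `μ(m, g) = (q ^ M(m, g) - 1) / (q - 1)`; the division is exact. -/
def numPolynomials (q m g : ℕ) : ℕ := (q ^ numMonomials m g - 1) / (q - 1)

/-- The rate of the theorem, as a function of the parameters and of `H = H_min`; `kt` is
`g (k - 1) + 1` and `s` is `min {μ, M(f, g)}`. -/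
def ppcRate (n k f g μ : ℕ) (H : ℝ) : ℝ :=
  let kt : ℕ := g * (k - 1) + 1
  let s : ℕ := min μ (numMonomials f g)
  let x : ℝ := (kt : ℝ) / (n : ℝ)
  if n ≤ kt then 1 / (f : ℝ) * H
  else ((k : ℝ) / (kt : ℝ) * (1 - x) * H) /
    (1 - x ^ s - ((s : ℝ) - (f : ℝ)) * (1 - x) * x ^ (μ - 1))

end

noncomputable section

/-! Put K = g(k-1)+1. If n ≤ K, reading k databases completely yields all messages
(`downloadAllScheme`). Otherwise, applying a candidate φ_u to what the databases store of one row
gives the values at the α_j of a polynomial of degree below K (`codePoly`). Any K databases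
determine this codeword, and its values at the γ_l are the evaluations on that row.

The n^μ rows are labelled by pairs (T, r), where T is a set of candidates and r is a word of digits
below n whose large letters (those ≥ K) are exactly the first |T|. A uniform signed permutation
hides the labels. For nonempty T and a word r with |T|-1 large letters, a database forms the signed
sum over u ∈ T of φ_u on the row (T \ {u}, r). If v is desired, the labels used for database j are
first moved by `Label.shift v j`. This permutes the labels, so every database sees a uniform signed
permutation, whatever v is: this is privacy.

For recovery, compare two message tuples with equal queries and answers; the differences of their
codewords give vanishing sums. A sum over S with v ∉ S is seen by K databases, hence vanishes as a
polynomial (`interference_eq_zero`). Up to sign it is the interference in a sum over S ∪ {v} at a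
database that does not see it directly. Removing it leaves K zeros of each difference for φ_v
(`desired_eq_zero`).

Not all sums are sent. For singletons the f message symbols suffice. Modulo constants, the
candidates are combinations of those in a set P of size min {μ, M(f, g)}
(`exists_finset_spanning_mod_const`). As the signs are those of a Koszul differential, the sums over
sets that meet P imply the others (`sum_boundary_eq_zero`). Counting what is sent gives the rate
(`sub_mul_card_answerIndex`). -/

/-- The sign of `u` in the boundary of a finite set `T`: `(-1)` to the number of elements of `T`
below `u`. -/
def boundarySign {μ : ℕ} (T : Finset (Fin μ)) (u : Fin μ) : ℤˣ :=
  (-1) ^ (T.filter (· < u)).card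

/-! ### Koszul signs and redundancy among the signed sums -/

section Koszul

variable {F : Type*} [Field F] {μ m : ℕ}

/-- The alternating form on `F ^ μ` with prescribed values on the increasing tuples of standard
basis vectors. -/
def alternatingOfFinset (F : Type*) [Field F] (μ m : ℕ) :
    (Finset (Fin μ) → F) →ₗ[F] (Fin μ → F) [⋀^Fin m]→ₗ[F] F :=
  (exteriorPower.alternatingMapLinearEquiv (R := F) (M := Fin μ → F) (N := F)
      (n := m)).symm.toLinearMap ∘ₗ
    (((Pi.basisFun F (Fin μ)).exteriorPower m).constr F).toLinearMap ∘ₗ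
    LinearMap.funLeft F F Subtype.val

theorem alternatingOfFinset_apply (y : Finset (Fin μ) → F) (T : Finset (Fin μ)) (hT : T.card = m) :
    alternatingOfFinset F μ m y (fun i => Pi.single (T.orderEmbOfFin hT i) 1) = y T := by
  have h := ((Pi.basisFun F (Fin μ)).exteriorPower m).constr_basis F
    (LinearMap.funLeft F F Subtype.val y) ⟨T, hT⟩
  rw [exteriorPower.basis_apply] at h
  simp only [LinearMap.funLeft_apply] at h
  rw [← h]
  simp only [alternatingOfFinset, LinearMap.comp_apply, LinearEquiv.coe_coe]
  rw [exteriorPower.alternatingMapLinearEquiv_symm_apply]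
  simp only [LinearMap.compAlternatingMap_apply, exteriorPower.ιMulti_family]
  congr 2
  ext i
  simp [Set.powersetCard.ofFinEmbEquiv_symm_apply]

theorem removeNth_orderEmbOfFin (T : Finset (Fin μ)) (hT : T.card = m + 1) (i : Fin (m + 1))
    (h : (T.erase (T.orderEmbOfFin hT i)).card = m) :
    i.removeNth (T.orderEmbOfFin hT) = (T.erase (T.orderEmbOfFin hT i)).orderEmbOfFin h := by
  apply Finset.orderEmbOfFin_unique
  · intro x
    simp only [Fin.removeNth, Finset.mem_erase]
    exact ⟨fun e => Fin.succAbove_ne i x ((T.orderEmbOfFin hT).injective e),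
      T.orderEmbOfFin_mem hT _⟩
  · exact (T.orderEmbOfFin hT).strictMono.comp (Fin.strictMono_succAbove i)

theorem boundarySign_orderEmbOfFin (T : Finset (Fin μ)) (hT : T.card = m) (i : Fin m) :
    boundarySign T (T.orderEmbOfFin hT i) = (-1) ^ (i : ℕ) := by
  unfold boundarySign
  congr 1
  have : T.filter (· < T.orderEmbOfFin hT i) =
      (Finset.univ.filter (· < i)).image (T.orderEmbOfFin hT) := by
    ext w
    simp only [Finset.mem_filter, Finset.mem_image, Finset.mem_univ, true_and]
    constructor
    · rintro ⟨hw, hlt⟩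
      have : w ∈ Set.range (T.orderEmbOfFin hT) := by
        rw [Finset.range_orderEmbOfFin]; exact hw
      obtain ⟨a, rfl⟩ := this
      exact ⟨a, by simpa using hlt, rfl⟩
    · rintro ⟨a, ha, rfl⟩
      exact ⟨T.orderEmbOfFin_mem hT _, by simpa using ha⟩
  rw [this, Finset.card_image_of_injective _ (T.orderEmbOfFin hT).injective, ← Fin.card_Iio i]
  congr 1
  ext a
  simp

/-- The boundary of a family of functions on finite sets, as an alternating form. -/
def boundaryForm (m : ℕ) (x : Fin μ → Finset (Fin μ) → F) :
    (Fin μ → F) [⋀^Fin (m + 1)]→ₗ[F] F :=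
  AlternatingMap.alternatizeUncurryFin
    (alternatingOfFinset F μ m ∘ₗ Fintype.linearCombination F x)

/-- Signed sums thus become values of one alternating form, so linear relations among the `x u` can
be exploited by changing its arguments from basis vectors to other vectors. -/
theorem boundaryForm_orderEmbOfFin (x : Fin μ → Finset (Fin μ) → F) (T : Finset (Fin μ))
    (hT : T.card = m + 1) :
    boundaryForm m x (fun i => Pi.single (T.orderEmbOfFin hT i) 1) =
      ∑ u ∈ T, ((boundarySign T u : ℤ) : F) * x u (T.erase u) := by
  have himg : T = Finset.univ.image (T.orderEmbOfFin hT) := by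
    ext w
    rw [← Finset.mem_coe, ← T.range_orderEmbOfFin hT]
    simp
  have hs : ∀ f : Fin μ → F, ∑ u ∈ T, f u = ∑ i, f (T.orderEmbOfFin hT i) := by
    intro f
    conv_lhs => rw [himg]
    rw [Finset.sum_image fun a _ b _ h => (T.orderEmbOfFin hT).injective h]
  rw [hs, boundaryForm, AlternatingMap.alternatizeUncurryFin_apply]
  refine Finset.sum_congr rfl fun i _ => ?_
  have hc : (T.erase (T.orderEmbOfFin hT i)).card = m := by
    rw [Finset.card_erase_of_mem (T.orderEmbOfFin_mem hT i), hT]; rfl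
  have hr : (i.removeNth fun i => (Pi.single (T.orderEmbOfFin hT i) (1 : F) : Fin μ → F)) =
      fun a => Pi.single ((T.erase (T.orderEmbOfFin hT i)).orderEmbOfFin hc a) 1 := by
    rw [← removeNth_orderEmbOfFin]
    rfl
  rw [hr, LinearMap.comp_apply, alternatingOfFinset_apply, boundarySign_orderEmbOfFin]
  simp [Fintype.linearCombination_apply_single]

/-- If the functions `x u` are combinations of those with `u ∈ P`, then their boundary vanishes on
the sets of a given size once it vanishes on those that meet `P`. -/
theorem sum_boundary_eq_zero (P : Finset (Fin μ)) (x : Fin μ → Finset (Fin μ) → F)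
    (c : Fin μ → Fin μ → F) (hx : ∀ u S, x u S = ∑ p ∈ P, c u p * x p S)
    (h : ∀ T : Finset (Fin μ), T.card = m + 1 → (T ∩ P).Nonempty →
      ∑ u ∈ T, ((boundarySign T u : ℤ) : F) * x u (T.erase u) = 0)
    (T : Finset (Fin μ)) (hT : T.card = m + 1) :
    ∑ u ∈ T, ((boundarySign T u : ℤ) : F) * x u (T.erase u) = 0 := by
  -- The form vanishes once an argument is a basis vector indexed by `P`: on distinct basis vectors
  -- this is `h` up to the sign of the sorting permutation, on repeated ones it is alternation.
  have hcurry : ∀ p ∈ P, (boundaryForm m x).curryLeft (Pi.single p 1) = 0 := by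
    intro p hp
    refine Module.Basis.ext_alternating (Pi.basisFun F (Fin μ)) fun t ht => ?_
    simp only [AlternatingMap.curryLeft_apply_apply, AlternatingMap.zero_apply, Pi.basisFun_apply]
    have hcons : (Matrix.vecCons (Pi.single p 1) fun i => (Pi.single (t i) (1 : F) : Fin μ → F)) =
        fun i => Pi.single ((Fin.cons p t : Fin (m + 1) → Fin μ) i) 1 := by
      ext i
      refine Fin.cases ?_ (fun i => ?_) i <;> simp
    rw [hcons]
    by_cases hinj : Function.Injective (Fin.cons p t : Fin (m + 1) → Fin μ)
    · set w : Fin (m + 1) → Fin μ := Fin.cons p t with hw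
      have hc : (Finset.univ.image w).card = m + 1 := by
        rw [Finset.card_image_of_injective _ hinj]; simp
      have hbij : Function.Bijective fun i =>
          (⟨w i, Finset.mem_image_of_mem w (Finset.mem_univ i)⟩ : Finset.univ.image w) := by
        constructor
        · intro a b hab
          exact hinj (by simpa using hab)
        · rintro ⟨a, ha⟩
          obtain ⟨i, -, rfl⟩ := Finset.mem_image.1 ha
          exact ⟨i, rfl⟩
      let σ : Equiv.Perm (Fin (m + 1)) :=
        ((Finset.univ.image w).orderIsoOfFin hc).toEquiv.trans (Equiv.ofBijective _ hbij).symm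
      have hσ : ∀ i, w (σ i) = (Finset.univ.image w).orderEmbOfFin hc i := by
        intro i
        have := (Equiv.ofBijective _ hbij).apply_symm_apply
          ((Finset.univ.image w).orderIsoOfFin hc i)
        exact congrArg Subtype.val this
      have key := boundaryForm_orderEmbOfFin x _ hc
      rw [h _ hc ⟨p, Finset.mem_inter.2 ⟨Finset.mem_image.2 ⟨0, Finset.mem_univ _, by simp [hw]⟩,
        hp⟩⟩] at key
      simp only [← hσ] at key
      have hp := (boundaryForm m x).map_perm (fun i => Pi.single (w i) 1) σ
      rw [Function.comp_def] at hp
      rw [key] at hp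
      rcases Int.units_eq_one_or (Equiv.Perm.sign σ) with h1 | h1 <;> rw [h1] at hp <;>
        simpa using hp.symm
    · rw [Function.Injective] at hinj
      push Not at hinj
      obtain ⟨a, b, hab, hne⟩ := hinj
      exact (boundaryForm m x).map_eq_zero_of_eq _ (by simp only [hab]) hne
  -- `π u` lies in the span of the basis vectors indexed by `P` and has the same image as the `u`-th
  -- basis vector under the linear map that sends basis vectors to the `x u`.
  let π : Fin μ → Fin μ → F := fun u => ∑ p ∈ P, c u p • Pi.single p 1
  have hπ : ∀ u, (boundaryForm m x).curryLeft (π u) = 0 := by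
    intro u
    simp only [π, map_sum, map_smul]
    exact Finset.sum_eq_zero fun p hp => by rw [hcurry p hp, smul_zero]
  have hker : ∀ u, Fintype.linearCombination F x (Pi.single u 1 - π u) = 0 := by
    intro u
    rw [map_sub]
    simp only [π, map_sum, map_smul, Fintype.linearCombination_apply_single, one_smul]
    rw [sub_eq_zero]
    ext S
    simp [hx u S]
  rw [← boundaryForm_orderEmbOfFin x T hT]
  have hsplit : (fun i => (Pi.single (T.orderEmbOfFin hT i) (1 : F) : Fin μ → F)) =
      (fun i => Pi.single (T.orderEmbOfFin hT i) 1 - π (T.orderEmbOfFin hT i)) +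
        fun i => π (T.orderEmbOfFin hT i) := by
    ext i; simp
  rw [hsplit, ← AlternatingMap.coe_multilinearMap, MultilinearMap.map_add_univ]
  refine Finset.sum_eq_zero fun s _ => ?_
  rw [AlternatingMap.coe_multilinearMap]
  -- In the term with all arguments in the kernel of that linear map, each summand of the boundary
  -- applies the map to some argument. Every other term has an argument `π u`, which kills it by
  -- `hπ`.
  by_cases hs : s = Finset.univ
  · subst hs
    rw [Finset.piecewise_univ, boundaryForm, AlternatingMap.alternatizeUncurryFin_apply]
    refine Finset.sum_eq_zero fun i _ => ?_
    rw [LinearMap.comp_apply, hker, map_zero]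
    simp
  · obtain ⟨i, hi⟩ : ∃ i, i ∉ s := by
      by_contra hcon
      push Not at hcon
      exact hs (Finset.eq_univ_iff_forall.2 hcon)
    set y := s.piecewise (fun i => Pi.single (T.orderEmbOfFin hT i) 1 - π (T.orderEmbOfFin hT i))
      fun i => π (T.orderEmbOfFin hT i) with hy
    have hyi : y i = π (T.orderEmbOfFin hT i) := by simp [hy, hi]
    have := (boundaryForm m x).map_insertNth i (y i) (i.removeNth y)
    rw [Fin.insertNth_self_removeNth, ← AlternatingMap.curryLeft_apply_apply, hyi, hπ] at this
    simpa using this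

end Koszul

/-! ### Labels of the rows and their shifts -/

/-- The labels of the rows: a set `T` of candidates and a word `r` of digits whose letters that are
at least `K` are exactly the first `T.card` ones. -/
abbrev Label (K n μ : ℕ) : Type :=
  {l : Finset (Fin μ) × (Fin μ → Fin n) // ∀ i, K ≤ (l.2 i : ℕ) ↔ (i : ℕ) < l.1.card}

namespace Label

variable {K n μ : ℕ}

/-- Only a fallback value for `mk`. For `K = 0` every letter is large, which forces the full set. -/
instance [NeZero n] : Inhabited (Label K n μ) :=
  ⟨if h : K = 0 then ⟨(Finset.univ, 0), fun i => by simp [h]⟩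
    else ⟨(∅, 0), fun i => by simp; omega⟩⟩

/-- The label `(T, r)`, if it is one. -/
def mk [NeZero n] (T : Finset (Fin μ)) (r : Fin μ → Fin n) : Label K n μ :=
  if h : ∀ i, K ≤ (r i : ℕ) ↔ (i : ℕ) < T.card then ⟨(T, r), h⟩ else default

theorem mk_eq [NeZero n] {T : Finset (Fin μ)} {r : Fin μ → Fin n}
    (h : ∀ i, K ≤ (r i : ℕ) ↔ (i : ℕ) < T.card) : (mk T r : Label K n μ) = ⟨(T, r), h⟩ :=
  dif_pos h

/-- The position `|T \ {v}|`. -/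
def pivot (v : Fin μ) (T : Finset (Fin μ)) : Fin μ :=
  ⟨(T.erase v).card, by
    calc (T.erase v).card < (Finset.univ : Finset (Fin μ)).card :=
          Finset.card_lt_card ⟨Finset.subset_univ _, fun h => by simpa using h (Finset.mem_univ v)⟩
      _ = μ := by simp⟩

theorem pivot_congr {v : Fin μ} {S T : Finset (Fin μ)} (h : S.erase v = T.erase v) :
    pivot v S = pivot v T := by
  simp [pivot, h]

/-- The pivot is position |T \ {v}|, which is below |T| precisely when `v` belongs to T. -/
theorem mem_iff (l : Label K n μ) (v : Fin μ) : v ∈ l.1.1 ↔ K ≤ (l.1.2 (pivot v l.1.1) : ℕ) := by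
  rw [l.2]
  by_cases h : v ∈ l.1.1
  · have := Finset.card_erase_add_one h
    simp only [h, pivot, true_iff]
    omega
  · simp [h, pivot]

/-- Whether `v` is in the set can be read off the digit at the pivot, so it need not be recorded.
This is why adding to that digit alone acts on the labels. -/
theorem ext_of_erase {l l' : Label K n μ} (v : Fin μ) (hT : l.1.1.erase v = l'.1.1.erase v)
    (hr : l.1.2 = l'.1.2) : l = l' := by
  refine Subtype.ext (Prod.ext ?_ hr)
  have hv : v ∈ l.1.1 ↔ v ∈ l'.1.1 := by rw [mem_iff, mem_iff, pivot_congr hT, hr]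
  ext w
  by_cases hw : w = v
  · rw [hw, hv]
  · have := Finset.ext_iff.1 hT w
    simpa [hw] using this

/-- Add `j` to the digit at the pivot, and let `v` be in the set according to the new digit. -/
def shift (v : Fin μ) (j : Fin n) (l : Label K n μ) : Label K n μ :=
  ⟨(if K ≤ (l.1.2 (pivot v l.1.1) + j : Fin n).val then insert v (l.1.1.erase v)
      else l.1.1.erase v,
    Function.update l.1.2 (pivot v l.1.1) (l.1.2 (pivot v l.1.1) + j)), by
    intro i
    have hl := l.2 i
    have hv := mem_iff l v
    have hins : (insert v (l.1.1.erase v)).card = (l.1.1.erase v).card + 1 :=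
      Finset.card_insert_of_notMem (Finset.notMem_erase _ _)
    have hcard : l.1.1.card = (l.1.1.erase v).card + if v ∈ l.1.1 then 1 else 0 := by
      split_ifs with h
      · exact (Finset.card_erase_add_one h).symm
      · rw [Finset.erase_eq_of_notMem h, add_zero]
    by_cases hi : i = pivot v l.1.1
    · have hp : (pivot v l.1.1 : ℕ) = (l.1.1.erase v).card := rfl
      subst hi
      dsimp only
      rw [Function.update_self, hp]
      split_ifs with h
      · simp only [h, hins, true_iff]; omega
      · simp only [h, false_iff]; omega
    · have hne : (i : ℕ) ≠ (l.1.1.erase v).card := fun e => hi (Fin.ext e)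
      simp only [Function.update_of_ne hi, hl, hcard]
      split_ifs <;> omega⟩

@[simp]
theorem shift_erase (v : Fin μ) (j : Fin n) (l : Label K n μ) :
    (shift v j l).1.1.erase v = l.1.1.erase v := by
  simp only [shift]
  split_ifs <;> simp

theorem shift_snd (v : Fin μ) (j : Fin n) (l : Label K n μ) :
    (shift v j l).1.2 =
      Function.update l.1.2 (pivot v l.1.1) (l.1.2 (pivot v l.1.1) + j) := rfl

variable [NeZero n]

theorem shift_shift (v : Fin μ) (i j : Fin n) (l : Label K n μ) :
    shift v i (shift v j l) = shift v (j + i) l := by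
  refine ext_of_erase v (by simp) ?_
  rw [shift_snd, shift_snd, shift_snd, pivot_congr (shift_erase v j l)]
  simp [add_assoc]

theorem shift_zero (v : Fin μ) (l : Label K n μ) : shift v 0 l = l :=
  ext_of_erase v (by simp) (by simp [shift_snd])

/-- The shift as a permutation of the labels. -/
def shiftEquiv (v : Fin μ) (j : Fin n) : Equiv.Perm (Label K n μ) where
  toFun := shift v j
  invFun := shift v (-j)
  left_inv l := by rw [shift_shift, add_neg_cancel, shift_zero]
  right_inv l := by rw [shift_shift, neg_add_cancel, shift_zero]

end Label

/-! ### Sign compatibility between interference with and without the desired index -/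

/-- The sign that a desired index `v` puts on a label with set `T`. -/
def insertSign {μ : ℕ} (v : Fin μ) (T : Finset (Fin μ)) : ℤˣ :=
  if v ∈ T then boundarySign T v else 1

/-- The sign rule behind ∂∂ = 0: removing `u` then `v` and removing `v` then `u` give opposite
signs. Hence the interference in the sum over S ∪ {v} is a multiple, by a sign independent of `u`,
of the sum over S. -/
theorem boundarySign_mul_insertSign {μ : ℕ} {S : Finset (Fin μ)} {u v : Fin μ} (hu : u ∈ S)
    (hv : v ∉ S) :
    boundarySign (insert v S) u * insertSign v ((insert v S).erase u) =
      -boundarySign (insert v S) v * boundarySign S u := by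
  have huv : u ≠ v := fun h => hv (h ▸ hu)
  have hvm : v ∈ (insert v S).erase u := by simp [huv.symm]
  rw [insertSign, if_pos hvm]
  unfold boundarySign
  have h1 : (insert v S).filter (· < v) = S.filter (· < v) := by
    rw [Finset.filter_insert, if_neg (lt_irrefl v)]
  have h2 : ((insert v S).erase u).filter (· < v) = (S.filter (· < v)).erase u := by
    rw [Finset.filter_erase, h1]
  rw [h1, h2, Finset.filter_insert]
  rcases lt_or_gt_of_ne huv with h | h
  · rw [if_neg (not_lt.2 h.le)]
    have hm : u ∈ S.filter (· < v) := by simp [hu, h]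
    rw [← Finset.card_erase_add_one hm, pow_succ]
    simp [mul_comm]
  · rw [if_pos h, Finset.card_insert_of_notMem (by simp [hv]), Finset.erase_eq_of_notMem
      (by simp [not_lt.2 h.le]), pow_succ]
    simp [mul_comm]

/-! ### Decoding: interference first, then the desired codewords -/

section Decode

open Polynomial

variable {F : Type*} [Field F] {K n μ : ℕ} [NeZero n]

theorem card_filter_sub_lt (hKn : K ≤ n) (t : Fin n) :
    (Finset.univ.filter fun j : Fin n => (t - j : Fin n).val < K).card = K := by
  rw [← Finset.card_map (Equiv.subLeft t).toEmbedding]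
  have : (Finset.univ.filter fun j : Fin n => (t - j : Fin n).val < K).map
      (Equiv.subLeft t).toEmbedding = Finset.univ.filter fun d : Fin n => d.val < K := by
    ext d
    simp only [Finset.mem_map_equiv, Finset.mem_filter, Finset.mem_univ, true_and,
      Equiv.subLeft_symm_apply]
    rw [show t - (-d + t) = d by abel]
  rw [this, Fin.card_filter_val_lt, min_eq_right hKn]

/-- The differences `t - j` are taken modulo `n`, so each residue below `K` comes from exactly one
`j`: there are `K` distinct zeros. -/
theorem eq_zero_of_eval_eq_zero_of_sub_lt {α : Fin n → F} (hα : Function.Injective α) (hKn : K ≤ n)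
    {p : F[X]} (hp : p.degree < K) (t : Fin n)
    (h : ∀ j : Fin n, (t - j : Fin n).val < K → p.eval (α j) = 0) : p = 0 := by
  refine Polynomial.eq_zero_of_degree_lt_of_eval_index_eq_zero
    (Finset.univ.filter fun j : Fin n => (t - j : Fin n).val < K) hα.injOn ?_ ?_
  · rwa [card_filter_sub_lt hKn]
  · intro j hj
    exact h j (by simpa using hj)

/-- The interference, which is common to all databases, vanishes. -/
theorem interference_eq_zero {α : Fin n → F} (hα : Function.Injective α) (hKn : K ≤ n)
    (v : Fin μ) (D : Fin μ → Label K n μ → F[X]) (hdeg : ∀ u l, (D u l).degree < K)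
    (H : ∀ (j : Fin n) (T : Finset (Fin μ)) (r : Fin μ → Fin n), T.Nonempty →
      (∀ i, K ≤ (r i : ℕ) ↔ (i : ℕ) + 1 < T.card) →
      ∑ u ∈ T, (((boundarySign T u * insertSign v (T.erase u) : ℤˣ) : ℤ) : F) *
        (D u (Label.shift v j (Label.mk (T.erase u) r))).eval (α j) = 0)
    (S : Finset (Fin μ)) (hv : v ∉ S) (c : Fin μ → Label K n μ) (r : Fin μ → Fin n)
    (hr : ∀ i : Fin μ, (i : ℕ) + 1 ≠ S.card → (K ≤ (r i : ℕ) ↔ (i : ℕ) + 1 < S.card))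
    (hc : ∀ u ∈ S, (c u).1.1.erase v = S.erase u ∧ (c u).1.2 = r) :
    ∑ u ∈ S, ((boundarySign S u : ℤ) : F[X]) * D u (c u) = 0 := by
  rcases S.eq_empty_or_nonempty with rfl | hS
  · simp
  have hcard : ∀ u ∈ S, (S.erase u).card + 1 = S.card := fun u hu => Finset.card_erase_add_one hu
  obtain ⟨p, hp⟩ : ∃ p : Fin μ, (p : ℕ) + 1 = S.card := by
    obtain ⟨u, hu⟩ := hS
    refine ⟨⟨(S.erase u).card, ?_⟩, hcard u hu⟩
    have := hcard u hu
    have h2 := Finset.card_le_univ S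
    simp only [Fintype.card_fin] at h2
    omega
  have hpiv : ∀ u ∈ S, Label.pivot v (S.erase u) = p := by
    intro u hu
    have hvu : v ∉ S.erase u := fun h => hv (Finset.mem_of_mem_erase h)
    have := hcard u hu
    ext
    simp only [Label.pivot, Finset.erase_eq_of_notMem hvu]
    omega
  refine eq_zero_of_eval_eq_zero_of_sub_lt hα hKn ?_ (r p) ?_
  · refine (Polynomial.degree_sum_le _ _).trans_lt ((Finset.sup_lt_iff ?_).2 fun u _ => ?_)
    · exact WithBot.bot_lt_coe K
    · rcases Int.units_eq_one_or (boundarySign S u) with h | h <;> simp [h, hdeg]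
  · intro j hj
    -- Database `j` reaches the labels `c u` by shifting a digit `r p - j`. Its word is admissible
    -- for `S` because `hj` makes this digit small.
    have := H j S (Function.update r p (r p - j)) hS ?_
    · rw [← this, Polynomial.eval_finsetSum]
      refine Finset.sum_congr rfl fun u hu => ?_
      have hvu : v ∉ S.erase u := fun h => hv (Finset.mem_of_mem_erase h)
      have hlab : ∀ i, K ≤ (Function.update r p (r p - j) i : ℕ) ↔
          (i : ℕ) < (S.erase u).card := by
        intro i
        by_cases hi : i = p
        · subst hi
          have := hcard u hu
          simp only [Function.update_self]
          omega
        · have h1 : (i : ℕ) ≠ p := fun h => hi (Fin.ext h)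
          have := hcard u hu
          rw [Function.update_of_ne hi, hr i (by omega)]
          omega
      have hcu : c u = Label.shift v j ⟨(S.erase u, Function.update r p (r p - j)), hlab⟩ := by
        refine Label.ext_of_erase v ?_ ?_
        · rw [Label.shift_erase, (hc u hu).1]
          exact (Finset.erase_eq_of_notMem hvu).symm
        · rw [Label.shift_snd, (hc u hu).2]
          simp [hpiv u hu]
      rw [Label.mk_eq hlab, ← hcu, insertSign, if_neg hvu]
      simp
    · intro i
      by_cases hi : i = p
      · subst hi
        simp only [Function.update_self]
        omega
      · have h1 : (i : ℕ) ≠ p := fun h => hi (Fin.ext h)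
        rw [Function.update_of_ne hi, hr i (by omega)]

/-- If all answers of the scheme vanish, then so do the codewords of the desired function. -/
theorem desired_eq_zero {α : Fin n → F} (hα : Function.Injective α) (hKn : K ≤ n)
    (v : Fin μ) (D : Fin μ → Label K n μ → F[X]) (hdeg : ∀ u l, (D u l).degree < K)
    (H : ∀ (j : Fin n) (T : Finset (Fin μ)) (r : Fin μ → Fin n), T.Nonempty →
      (∀ i, K ≤ (r i : ℕ) ↔ (i : ℕ) + 1 < T.card) →
      ∑ u ∈ T, (((boundarySign T u * insertSign v (T.erase u) : ℤˣ) : ℤ) : F) *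
        (D u (Label.shift v j (Label.mk (T.erase u) r))).eval (α j) = 0)
    (l : Label K n μ) : D v l = 0 := by
  obtain ⟨S, hS⟩ : ∃ S, S = l.1.1.erase v := ⟨_, rfl⟩
  have hv : v ∉ S := by simp [hS]
  set p := Label.pivot v l.1.1 with hp
  have hpS : (p : ℕ) = S.card := by rw [hp, hS]; rfl
  have hlr : ∀ i, i ≠ p → (K ≤ (l.1.2 i : ℕ) ↔ (i : ℕ) < S.card) := by
    intro i hi
    have h1 : (i : ℕ) ≠ p := fun h => hi (Fin.ext h)
    rw [l.2 i]
    by_cases hvl : v ∈ l.1.1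
    · have := Finset.card_erase_add_one hvl
      rw [← hS] at this
      omega
    · rw [Finset.erase_eq_of_notMem hvl] at hS
      rw [hS]
  refine eq_zero_of_eval_eq_zero_of_sub_lt hα hKn (hdeg v l) (l.1.2 p) fun j hj => ?_
  set r := Function.update l.1.2 p (l.1.2 p - j) with hr
  have hrS : ∀ i, K ≤ (r i : ℕ) ↔ (i : ℕ) < S.card := by
    intro i
    by_cases hi : i = p
    · rw [hi, hr, Function.update_self]
      omega
    · rw [hr, Function.update_of_ne hi, hlr i hi]
  have hins : (insert v S).card = S.card + 1 := Finset.card_insert_of_notMem hv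
  -- Subtracting `j` at the pivot undoes the shift, so the `v`-term of this sum is the value of `D v
  -- l` at `α j`.
  have key := H j (insert v S) r ⟨v, Finset.mem_insert_self _ _⟩ fun i => by
    rw [hrS i, hins]; omega
  rw [Finset.sum_insert hv, Finset.erase_insert hv, Label.mk_eq hrS] at key
  have hl : Label.shift v j ⟨(S, r), hrS⟩ = l := by
    refine Label.ext_of_erase v ?_ ?_
    · rw [Label.shift_erase, ← hS]
      exact Finset.erase_eq_of_notMem hv
    · rw [Label.shift_snd]
      have : Label.pivot v S = p := Fin.ext (by
        simp [hpS, Label.pivot, hv])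
      simp [this, hr]
  rw [hl, insertSign, if_neg hv] at key
  have hI : ∑ u ∈ S, (((boundarySign (insert v S) u *
      insertSign v ((insert v S).erase u) : ℤˣ) : ℤ) : F) *
      (D u (Label.shift v j (Label.mk ((insert v S).erase u) r))).eval (α j) = 0 := by
    rcases S.eq_empty_or_nonempty with hS0 | hne
    · simp [hS0]
    have hval : ∀ u ∈ S, ∀ i : Fin μ, K ≤ (r i : ℕ) ↔ (i : ℕ) < ((insert v S).erase u).card := by
      intro u hu i
      have := Finset.card_erase_add_one (Finset.mem_insert_of_mem (b := v) hu)
      rw [hrS i]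
      omega
    have her : ∀ u ∈ S, ((insert v S).erase u).erase v = S.erase u := by
      intro u hu
      rw [Finset.erase_right_comm, Finset.erase_insert hv]
    have hpc : 0 < S.card := hne.card_pos
    obtain ⟨q, hq⟩ : ∃ q : Fin μ, (q : ℕ) + 1 = S.card :=
      ⟨⟨S.card - 1, by omega⟩, by simp only; omega⟩
    have hpiv : ∀ u ∈ S, Label.pivot v ((insert v S).erase u) = q := by
      intro u hu
      have := Finset.card_erase_add_one hu
      refine Fin.ext ?_
      simp only [Label.pivot, her u hu]
      omega
    -- Here the digit of `r` at `q` is large, so database `j` sends no sum over `S` with these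
    -- labels. The polynomial identity comes from the `K` databases that do.
    have h0 := interference_eq_zero hα hKn v D hdeg H S hv
      (fun u => Label.shift v j (Label.mk ((insert v S).erase u) r))
      (Function.update r q (r q + j)) (fun i hi => by
        have h1 : i ≠ q := fun h => hi (by rw [h, hq])
        have h2 : (i : ℕ) ≠ q := fun h => h1 (Fin.ext h)
        rw [Function.update_of_ne h1, hrS i]
        omega) (fun u hu => by
        rw [Label.mk_eq (hval u hu), Label.shift_erase, Label.shift_snd]
        exact ⟨her u hu, by simp [hpiv u hu]⟩)
    have h1 := congrArg (fun q : F[X] =>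
      -((boundarySign (insert v S) v : ℤ) : F) * q.eval (α j)) h0
    simp only [Polynomial.eval_finsetSum, Polynomial.eval_zero, mul_zero, Finset.mul_sum] at h1
    rw [← h1]
    refine Finset.sum_congr rfl fun u hu => ?_
    rw [boundarySign_mul_insertSign hu hv]
    simp [mul_assoc]
  rw [hI, add_zero] at key
  rcases Int.units_eq_one_or (boundarySign (insert v S) v) with h | h <;>
    simpa [h] using key

end Decode

/-! ### Spanning subfamilies of the candidates modulo constants -/

section Rank

variable {F : Type*} [Field F] {f g μ : ℕ}

/-- A finite family spans the same space as one of its subfamilies of prescribed size, if this size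
is at least the dimension. -/
theorem exists_finset_card_eq_spanning {E : Type*} [AddCommGroup E] [Module F E]
    [FiniteDimensional F E] (w : Fin μ → E) {s : ℕ} (hs : min μ (Module.finrank F E) ≤ s)
    (hsμ : s ≤ μ) :
    ∃ P : Finset (Fin μ), P.card = s ∧
      ∃ c : Fin μ → Fin μ → F, ∀ u, w u = ∑ p ∈ P, c u p • w p := by
  classical
  obtain ⟨κ, a, ha, hspan, hli⟩ := exists_linearIndependent' F w
  have : Finite κ := Finite.of_injective a ha
  have : Fintype κ := Fintype.ofFinite κ
  have h1 := hli.fintype_card_le_finrank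
  have h2 := Fintype.card_le_of_injective a ha
  rw [Fintype.card_fin] at h2
  -- A maximal independent subfamily may be smaller than `s`; it is padded to the exact size.
  obtain ⟨P, hP, hcard⟩ := Finset.exists_superset_card_eq (s := Finset.univ.image a) (n := s)
    (by rw [Finset.card_image_of_injective _ ha, Finset.card_univ]; omega) (by simpa using hsμ)
  have hmem : ∀ u, ∃ c : Fin μ → F, ∑ p ∈ P, c p • w p = w u := by
    intro u
    rw [← Submodule.mem_span_image_finset_iff_exists_fun']
    have hu : w u ∈ Submodule.span F (Set.range (w ∘ a)) := by
      rw [hspan]; exact Submodule.subset_span ⟨u, rfl⟩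
    refine Submodule.span_mono ?_ hu
    rintro _ ⟨i, rfl⟩
    exact ⟨a i, hP (Finset.mem_image_of_mem a (Finset.mem_univ i)), rfl⟩
  choose c hc using hmem
  exact ⟨P, hcard, c, fun u => (hc u).symm⟩

/-- Exponents of the homogeneous monomials of degree `g` in `f + 1` variables, except the power of
the first variable; they stand for the nonconstant monomials of degree at most `g` in `f`
variables. -/
def homogeneousExponents (f g : ℕ) : Finset (Fin (f + 1) →₀ ℕ) :=
  ((Finset.univ : Finset (Fin (f + 1))).finsuppAntidiag g).erase (Finsupp.single 0 g)

theorem card_homogeneousExponents (f g : ℕ) :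
    (homogeneousExponents f g).card = numMonomials f g := by
  rw [homogeneousExponents, Finset.card_erase_of_mem (by simp),
    Finset.card_finsuppAntidiag_nat_eq_choose, numMonomials]
  simp only [Finset.card_univ, Fintype.card_fin]
  rw [show f + 1 + g - 1 = g + f by omega]

/-- Polynomials of degree at most `g` are, up to constants, combinations of at most
`numMonomials f g` of them. -/
theorem exists_finset_spanning_mod_const (φ : Fin μ → MvPolynomial (Fin f) F)
    (hdeg : ∀ v, (φ v).totalDegree ≤ g) :
    ∃ P : Finset (Fin μ), P.card = min μ (numMonomials f g) ∧
      ∃ (a : Fin μ → F) (c : Fin μ → Fin μ → F),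
        ∀ u, φ u = MvPolynomial.C (a u) + ∑ p ∈ P, c u p • φ p := by
  let ψ : MvPolynomial (Fin f) F →ₗ[F] (homogeneousExponents f g → F) :=
    LinearMap.pi fun e => MvPolynomial.lcoeff F e.1.tail
  obtain ⟨P, hP, c, hc⟩ := exists_finset_card_eq_spanning (F := F) (s := min μ (numMonomials f g))
    (fun u => ψ (φ u)) (by simp [card_homogeneousExponents]) (min_le_left _ _)
  refine ⟨P, hP, fun u => (φ u - ∑ p ∈ P, c u p • φ p).coeff 0, c, fun u => ?_⟩
  have hzero : ∀ m : Fin f →₀ ℕ, m ≠ 0 → (φ u - ∑ p ∈ P, c u p • φ p).coeff m = 0 := by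
    intro m hm
    by_cases hmg : m.sum (fun _ e => e) ≤ g
    · have hsum : ∑ i, m i ≤ g := by
        rwa [Finsupp.sum_fintype _ _ fun _ => rfl] at hmg
      -- Homogenization: the extra variable takes up the missing degree.
      let e : Fin (f + 1) →₀ ℕ := Finsupp.cons (g - ∑ i, m i) m
      have he : e ∈ homogeneousExponents f g := by
        refine Finset.mem_erase.2 ⟨fun h => hm ?_, ?_⟩
        · ext i
          have := DFunLike.congr_fun h i.succ
          simpa [e, Finsupp.cons_succ] using this
        · rw [Finset.mem_finsuppAntidiag]
          refine ⟨?_, Finset.subset_univ _⟩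
          rw [Fin.sum_univ_succ]
          simp only [e, Finsupp.cons_zero, Finsupp.cons_succ]
          omega
      have hψ : ψ (φ u - ∑ p ∈ P, c u p • φ p) = 0 := by
        rw [map_sub, map_sum, sub_eq_zero]
        simpa using hc u
      have := congrFun hψ ⟨e, he⟩
      simpa [ψ, e, Finsupp.tail_cons] using this
    · have hd : ∀ v, (φ v).coeff m = 0 := fun v =>
        MvPolynomial.coeff_eq_zero_of_totalDegree_lt (by
          have := hdeg v
          rw [Finsupp.sum] at hmg
          omega)
      simp [MvPolynomial.coeff_sum, hd]
  rw [← sub_eq_iff_eq_add]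
  ext m
  by_cases hm : m = 0
  · subst hm; simp
  · rw [hzero m hm, MvPolynomial.coeff_C, if_neg (Ne.symm hm)]

end Rank

/-! ### Numbers of rows and of downloaded symbols -/

section Count

variable {K n μ : ℕ}

theorem card_digitWords (hKn : K ≤ n) {a : ℕ} (ha : a ≤ μ) :
    Fintype.card {r : Fin μ → Fin n // ∀ i, K ≤ (r i : ℕ) ↔ (i : ℕ) < a} =
      (n - K) ^ a * K ^ (μ - a) := by
  have hsmall : (Finset.univ.filter fun d : Fin n => (d : ℕ) < K).card = K := by
    rw [Fin.card_filter_val_lt, min_eq_right hKn]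
  have hlarge : (Finset.univ.filter fun d : Fin n => K ≤ (d : ℕ)).card = n - K := by
    have := Finset.card_filter_add_card_filter_not (s := (Finset.univ : Finset (Fin n)))
      (fun d : Fin n => (d : ℕ) < K)
    simp only [not_lt, Finset.card_univ, Fintype.card_fin] at this
    omega
  rw [Fintype.card_subtype]
  have : (Finset.univ.filter fun r : Fin μ → Fin n => ∀ i, K ≤ (r i : ℕ) ↔ (i : ℕ) < a) =
      Fintype.piFinset fun i : Fin μ =>
        Finset.univ.filter fun d : Fin n => K ≤ (d : ℕ) ↔ (i : ℕ) < a := by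
    ext r
    simp [Fintype.mem_piFinset]
  rw [this, Fintype.card_piFinset]
  have hi : ∀ i : Fin μ, (Finset.univ.filter fun d : Fin n => K ≤ (d : ℕ) ↔ (i : ℕ) < a).card =
      if (i : ℕ) < a then n - K else K := by
    intro i
    split_ifs with h
    · simp only [h, iff_true, hlarge]
    · simp only [h, iff_false, not_le, hsmall]
  simp only [hi]
  rw [Finset.prod_ite, Finset.prod_const, Finset.prod_const, Fin.card_filter_val_lt,
    min_eq_right ha]
  congr 2
  have := Finset.card_filter_add_card_filter_not (s := (Finset.univ : Finset (Fin μ)))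
    (fun i : Fin μ => (i : ℕ) < a)
  rw [Fin.card_filter_val_lt, min_eq_right ha, Finset.card_univ, Fintype.card_fin] at this
  omega

/-- Grouping by the set T, this is the binomial expansion of ((n - K) + K)^μ. -/
theorem card_label (hKn : K ≤ n) : Fintype.card (Label K n μ) = n ^ μ := by
  let e : Label K n μ ≃ Σ T : Finset (Fin μ),
      {r : Fin μ → Fin n // ∀ i, K ≤ (r i : ℕ) ↔ (i : ℕ) < T.card} :=
    { toFun := fun l => ⟨l.1.1, l.1.2, l.2⟩
      invFun := fun s => ⟨(s.1, s.2.1), s.2.2⟩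
      left_inv := fun _ => rfl
      right_inv := fun _ => rfl }
  rw [Fintype.card_congr e, Fintype.card_sigma]
  have h : ∀ T : Finset (Fin μ), T.card ≤ μ := fun T => by simpa using Finset.card_le_univ T
  simp only [fun T : Finset (Fin μ) => card_digitWords (K := K) hKn (h T)]
  have := Fintype.sum_pow_mul_eq_add_pow (Fin μ) (n - K) K
  rw [Fintype.card_fin, Nat.sub_add_cancel hKn] at this
  exact this

/-- The symbols in the answer of a database: the messages at the rows that are not combined with
others, and the sums over the sets of at least two candidates that meet `P`. -/
abbrev AnswerIndex (f K n : ℕ) {μ : ℕ} (P : Finset (Fin μ)) : Type :=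
  (Fin f × {r : Fin μ → Fin n // ∀ i, K ≤ (r i : ℕ) ↔ (i : ℕ) < 0}) ⊕
    {l : Finset (Fin μ) × (Fin μ → Fin n) // ((l.1 ∩ P).Nonempty ∧ 2 ≤ l.1.card) ∧
      ∀ i, K ≤ (l.2 i : ℕ) ↔ (i : ℕ) < l.1.card - 1}

theorem card_answerIndex (hKn : K ≤ n) (f : ℕ) (P : Finset (Fin μ)) :
    Fintype.card (AnswerIndex f K n P) =
      f * K ^ μ + ∑ T : Finset (Fin μ) with (T ∩ P).Nonempty ∧ 2 ≤ T.card,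
        (n - K) ^ (T.card - 1) * K ^ (μ - (T.card - 1)) := by
  let e : {l : Finset (Fin μ) × (Fin μ → Fin n) // ((l.1 ∩ P).Nonempty ∧ 2 ≤ l.1.card) ∧
      ∀ i, K ≤ (l.2 i : ℕ) ↔ (i : ℕ) < l.1.card - 1} ≃
      Σ T : {T : Finset (Fin μ) // (T ∩ P).Nonempty ∧ 2 ≤ T.card},
        {r : Fin μ → Fin n // ∀ i, K ≤ (r i : ℕ) ↔ (i : ℕ) < T.1.card - 1} :=
    { toFun := fun l => ⟨⟨l.1.1, l.2.1⟩, l.1.2, l.2.2⟩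
      invFun := fun s => ⟨(s.1.1, s.2.1), s.1.2, s.2.2⟩
      left_inv := fun _ => rfl
      right_inv := fun _ => rfl }
  have h : ∀ T : Finset (Fin μ), T.card - 1 ≤ μ := fun T => by
    have := Finset.card_le_univ T
    simp only [Fintype.card_fin] at this
    omega
  rw [Fintype.card_sum, Fintype.card_prod, Fintype.card_fin, card_digitWords hKn (Nat.zero_le _),
    Fintype.card_congr e, Fintype.card_sigma]
  simp only [fun T : Finset (Fin μ) => card_digitWords (K := K) hKn (h T)]
  rw [pow_zero, one_mul, Nat.sub_zero]
  congr 1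
  exact (Finset.sum_subtype (p := fun T : Finset (Fin μ) => (T ∩ P).Nonempty ∧ 2 ≤ T.card)
    (Finset.univ.filter fun T : Finset (Fin μ) => (T ∩ P).Nonempty ∧ 2 ≤ T.card) (by simp)
    fun T => (n - K) ^ (T.card - 1) * K ^ (μ - (T.card - 1))).symm

/-- The sets that miss `P` are the subsets of its complement, so both the full sum and the excluded
one are binomial expansions. -/
theorem sum_filter_inter_nonempty (a b : ℝ) (P : Finset (Fin μ)) :
    ∑ T : Finset (Fin μ) with (T ∩ P).Nonempty, a ^ T.card * b ^ (μ - T.card) =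
      (a + b) ^ μ - b ^ P.card * (a + b) ^ (μ - P.card) := by
  have hall := Fintype.sum_pow_mul_eq_add_pow (Fin μ) a b
  rw [Fintype.card_fin] at hall
  rw [← hall, ← Finset.sum_filter_add_sum_filter_not Finset.univ
    (fun T : Finset (Fin μ) => (T ∩ P).Nonempty), eq_sub_iff_add_eq]
  congr 1
  have hcompl : Pᶜ.card = μ - P.card := by rw [Finset.card_compl, Fintype.card_fin]
  have hf : (Finset.univ.filter fun T : Finset (Fin μ) => ¬(T ∩ P).Nonempty) = Pᶜ.powerset := by
    ext T
    simp [Finset.not_nonempty_iff_eq_empty, ← Finset.disjoint_iff_inter_eq_empty,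
      Finset.subset_compl_iff_disjoint_right]
  have hP : P.card ≤ μ := by simpa using Finset.card_le_univ P
  rw [hf, ← hcompl, ← Finset.sum_pow_mul_eq_add_pow a b Pᶜ, Finset.mul_sum]
  refine Finset.sum_congr rfl fun T hT => ?_
  have := Finset.card_le_card (Finset.mem_powerset.1 hT)
  rw [hcompl] at this ⊢
  rw [show μ - T.card = P.card + (μ - P.card - T.card) by omega, pow_add]
  ring

/-- The factor n - K raises the exponent |T| - 1 to |T|, which makes the binomial identity
applicable. The last term removes the singletons of `P`, in whose place the f messages are sent. -/
theorem sub_mul_card_answerIndex (hKn : K ≤ n) (f : ℕ) (P : Finset (Fin μ)) :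
    ((n : ℝ) - K) * Fintype.card (AnswerIndex f K n P) =
      f * ((n : ℝ) - K) * K ^ μ + K * ((n : ℝ) ^ μ - K ^ P.card * (n : ℝ) ^ (μ - P.card)) -
        P.card * ((n : ℝ) - K) * K ^ μ := by
  have hsum := sum_filter_inter_nonempty ((n : ℝ) - K) K P
  rw [sub_add_cancel] at hsum
  rw [← hsum, card_answerIndex hKn, ← Finset.sum_filter_add_sum_filter_not
    (Finset.univ.filter fun T : Finset (Fin μ) => (T ∩ P).Nonempty) (fun T => 2 ≤ T.card),
    Finset.filter_filter, Finset.filter_filter]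
  have hone : (Finset.univ.filter fun T : Finset (Fin μ) => (T ∩ P).Nonempty ∧ ¬2 ≤ T.card) =
      P.map ⟨fun p => {p}, Finset.singleton_injective⟩ := by
    ext T
    simp only [Finset.mem_filter, Finset.mem_univ, true_and, Finset.mem_map,
      Function.Embedding.coeFn_mk]
    constructor
    · rintro ⟨⟨p, hp⟩, hT⟩
      rw [Finset.mem_inter] at hp
      refine ⟨p, hp.2, ?_⟩
      exact Finset.eq_of_subset_of_card_le (by simpa using hp.1) (by simp; omega)
    · rintro ⟨p, hp, rfl⟩
      simp [hp]
  rw [hone, Finset.sum_map]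
  simp only [Function.Embedding.coeFn_mk, Finset.card_singleton, Finset.sum_const, nsmul_eq_mul]
  push_cast [Nat.cast_sub hKn]
  have hterm : ((n : ℝ) - K) * ∑ T : Finset (Fin μ) with (T ∩ P).Nonempty ∧ 2 ≤ T.card,
        ((n : ℝ) - K) ^ (T.card - 1) * (K : ℝ) ^ (μ - (T.card - 1)) =
      K * ∑ T : Finset (Fin μ) with (T ∩ P).Nonempty ∧ 2 ≤ T.card,
        ((n : ℝ) - K) ^ T.card * (K : ℝ) ^ (μ - T.card) := by
    rw [Finset.mul_sum, Finset.mul_sum]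
    refine Finset.sum_congr rfl fun T hT => ?_
    have h2 : 2 ≤ T.card := (Finset.mem_filter.1 hT).2.2
    have h3 := Finset.card_le_univ T
    simp only [Fintype.card_fin] at h3
    rw [show μ - (T.card - 1) = μ - T.card + 1 by omega, pow_succ]
    conv_rhs => rw [show T.card = T.card - 1 + 1 by omega, pow_succ]
    rw [show μ - (T.card - 1 + 1) = μ - T.card by omega]
    ring
  rw [mul_add, hterm]
  -- The singletons carry the exponent `μ - 1`; a nonempty `P` ensures `μ ≥ 1`, so that the
  -- truncated subtraction is exact.
  rcases P.eq_empty_or_nonempty with rfl | ⟨p, -⟩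
  · simp; ring
  · have : 0 < μ := p.pos
    obtain ⟨m, rfl⟩ : ∃ m, μ = m + 1 := ⟨μ - 1, by omega⟩
    simp only [Nat.add_sub_cancel, pow_succ]
    ring

end Count

/-! ### Sufficient conditions for recovery and privacy -/

/-- The conditional entropy vanishes if `X` is a function of `Y`. -/
theorem condEntropy_map_eq_zero {Ω α γ : Type*} [Fintype α] [Fintype γ] (b : ℝ) (P : PMF Ω)
    (X : Ω → α) (Y : Ω → γ) (h : ∀ ω ω', Y ω = Y ω' → X ω = X ω') :
    condEntropy b (P.map fun ω => (X ω, Y ω)) = 0 := by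
  classical
  rw [condEntropy, neg_eq_zero]
  refine Finset.sum_eq_zero fun x _ => Finset.sum_eq_zero fun y _ => ?_
  rw [PMF.map_comp]
  by_cases hxy : ∃ ω, X ω = x ∧ Y ω = y
  · obtain ⟨ω, rfl, rfl⟩ := hxy
    have heq : (P.map fun ω => (X ω, Y ω)) (X ω, Y ω) =
        (P.map (Prod.snd ∘ fun ω => (X ω, Y ω))) (Y ω) := by
      rw [PMF.map_apply, PMF.map_apply]
      refine tsum_congr fun ω' => ?_
      simp only [Function.comp_apply, Prod.mk.injEq]
      refine if_congr ?_ rfl rfl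
      exact ⟨fun h' => h'.2, fun h' => ⟨h _ _ h', h'⟩⟩
    rw [heq]
    by_cases h0 : ((P.map (Prod.snd ∘ fun ω => (X ω, Y ω))) (Y ω)).toReal = 0
    · rw [h0, zero_mul]
    · rw [div_self h0, Real.logb_one, mul_zero]
  · have h0 : (P.map fun ω => (X ω, Y ω)) (x, y) = 0 := by
      rw [PMF.map_apply, ENNReal.tsum_eq_zero]
      intro ω
      rw [if_neg]
      intro h'
      rw [Prod.mk.injEq] at h'
      exact hxy ⟨ω, h'.1.symm, h'.2.symm⟩
    rw [h0, ENNReal.toReal_zero, zero_mul]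

theorem PMF.map_uniformOfFintype_of_bijective {α β : Type*} [Fintype α] [Fintype β] [Nonempty α]
    [Nonempty β] {e : α → β} (he : Function.Bijective e) :
    (PMF.uniformOfFintype α).map e = PMF.uniformOfFintype β := by
  classical
  ext b
  obtain ⟨a, rfl⟩ := he.2 b
  rw [PMF.map_apply, tsum_eq_single a, if_pos rfl]
  · simp [Fintype.card_of_bijective he]
  · intro a' ha'
    rw [if_neg fun h => ha' (he.1 h).symm]

namespace PCScheme

variable {F : Type*} [Field F] [Fintype F] {n f μ β k : ℕ} (S : PCScheme F n f μ β)

/-- A scheme is private if the law of each query does not depend on the desired index. -/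
theorem isPrivate_of_map_query_eq (G : Matrix (Fin k) (Fin n) F) (φ : Fin μ → (Fin f → F) → F)
    (h : ∀ v v' j, S.randLaw.map (fun r => S.query v r j) =
      S.randLaw.map (fun r => S.query v' r j)) : S.IsPrivate G φ := by
  have key : ∀ v j, ((S.jointLaw k).map fun ω =>
      (S.query v ω.1 j, S.answerVar G v ω j, fun u => functionEval (φ u) ω.2)) =
      (S.randLaw.map fun r => S.query v r j).bind fun q => (messageLaw F f β k).map fun W =>
        (q, S.answer j q (storedData G W j), fun u => functionEval (φ u) W) := by
    intro v j
    rw [jointLaw, PMF.map_bind, PMF.bind_map]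
    simp only [PMF.map_comp]
    rfl
  intro v v' j
  rw [key, key, h v v' j]

/-- Recovery holds if the queries and answers determine the desired evaluation. -/
theorem isRecoverable_of_determined (G : Matrix (Fin k) (Fin n) F) (φ : Fin μ → (Fin f → F) → F)
    (h : ∀ v (r r' : S.Rand) (W W' : Messages F f β k),
      (∀ j, S.query v r j = S.query v r' j) →
      (∀ j, S.answerVar G v (r, W) j = S.answerVar G v (r', W') j) →
      functionEval (φ v) W = functionEval (φ v) W') : S.IsRecoverable G φ := by
  intro v
  refine condEntropy_map_eq_zero _ _ (fun ω : S.Rand × Messages F f β k => functionEval (φ v) ω.2)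
    (fun ω => (S.answerVar G v ω, S.query v ω.1)) fun ω ω' hY => ?_
  rw [Prod.mk.injEq] at hY
  exact h v ω.1 ω'.1 ω.2 ω'.2 (fun j => congrFun hY.2 j) fun j => congrFun hY.1 j

end PCScheme

/-! ### Candidates on stored data as polynomial codewords -/

section CodePoly

open Polynomial

variable {F : Type*} [Field F] {n k f β : ℕ}

/-- The polynomial whose values at the points `α j` are the values of `φ` on the `i`-th stored
symbols, and whose values at the points `γ l` are those on the `i`-th rows of the messages. -/
def codePoly (γ : Fin k → F) (W : Messages F f β k) (φ : MvPolynomial (Fin f) F) (i : Fin β) :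
    F[X] :=
  MvPolynomial.aeval (fun m => Lagrange.interpolate Finset.univ γ (W m i)) φ

theorem eval_codePoly (γ : Fin k → F) (W : Messages F f β k) (φ : MvPolynomial (Fin f) F)
    (i : Fin β) (z : F) :
    (codePoly γ W φ i).eval z =
      MvPolynomial.eval (fun m => (Lagrange.interpolate Finset.univ γ (W m i)).eval z) φ := by
  have := MvPolynomial.comp_aeval_apply (fun m => Lagrange.interpolate Finset.univ γ (W m i))
    (Polynomial.aeval (R := F) z) φ
  rw [Polynomial.coe_aeval_eq_eval] at this
  rw [codePoly, this, MvPolynomial.aeval_eq_eval]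

theorem storedData_eq_eval (α : Fin n → F) (γ : Fin k → F) (W : Messages F f β k) (j : Fin n)
    (m : Fin f) (i : Fin β) :
    storedData (lagrangeGenerator α γ) W j m i =
      (Lagrange.interpolate Finset.univ γ (W m i)).eval (α j) := by
  simp [storedData, lagrangeGenerator, Matrix.vecMul, dotProduct, Lagrange.interpolate_apply,
    Polynomial.eval_finsetSum]

theorem eval_codePoly_storage (α : Fin n → F) (γ : Fin k → F) (W : Messages F f β k)
    (φ : MvPolynomial (Fin f) F) (i : Fin β) (j : Fin n) :
    (codePoly γ W φ i).eval (α j) =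
      MvPolynomial.eval (fun m => storedData (lagrangeGenerator α γ) W j m i) φ := by
  simp only [eval_codePoly, storedData_eq_eval]

theorem eval_codePoly_message {γ : Fin k → F} (hγ : Function.Injective γ) (W : Messages F f β k)
    (φ : MvPolynomial (Fin f) F) (i : Fin β) (l : Fin k) :
    (codePoly γ W φ i).eval (γ l) = MvPolynomial.eval (fun m => W m i l) φ := by
  simp only [eval_codePoly, Lagrange.eval_interpolate_at_node _ hγ.injOn (Finset.mem_univ l)]

theorem natDegree_codePoly_le {γ : Fin k → F} (hγ : Function.Injective γ) (hk : 1 ≤ k)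
    (W : Messages F f β k) (φ : MvPolynomial (Fin f) F) {g : ℕ} (hφ : φ.totalDegree ≤ g)
    (i : Fin β) : (codePoly γ W φ i).natDegree ≤ g * (k - 1) := by
  refine MvPolynomial.aeval_natDegree_le φ hφ _ fun m => ?_
  have h := Lagrange.degree_interpolate_lt (s := Finset.univ) (W m i) hγ.injOn
  rw [Finset.card_univ, Fintype.card_fin] at h
  by_cases h0 : Lagrange.interpolate Finset.univ γ (W m i) = 0
  · simp [h0]
  · have := (Polynomial.natDegree_lt_iff_degree_lt h0).2 h
    omega

end CodePoly

/-! ### The signed-sum scheme for n > K -/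

section Scheme

variable {F : Type*} [Field F] {K n f μ : ℕ} [NeZero n]

/-- The signed permutations of the labels that serve as queries. -/
abbrev SignedPerm (K n μ : ℕ) : Type := Equiv.Perm (Label K n μ) × (Label K n μ → ℤˣ)

instance : Fintype (SignedPerm K n μ) := Fintype.ofFinite _

/-- The number of the row that a query assigns to the label `(T, r)`. -/
def SignedPerm.row (q : SignedPerm K n μ) (T : Finset (Fin μ)) (r : Fin μ → Fin n) :
    Fin (Fintype.card (Label K n μ)) :=
  Fintype.equivFin _ (q.1 (Label.mk T r))

/-- The query to database `j` when `v` is desired. -/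
def shiftQuery (v : Fin μ) (q : SignedPerm K n μ) (j : Fin n) : SignedPerm K n μ :=
  ((Label.shiftEquiv v j).trans q.1,
    fun l => insertSign v l.1.1 * q.2 (Label.shiftEquiv v j l))

/-- Gives privacy, since a bijection preserves the uniform law, and lets a single query reveal the
user's randomness in the proof of recovery. -/
theorem shiftQuery_bijective (v : Fin μ) (j : Fin n) :
    Function.Bijective fun q : SignedPerm K n μ => shiftQuery v q j := by
  refine (Finite.injective_iff_bijective).1 fun q q' h => ?_
  simp only [shiftQuery, Prod.mk.injEq] at h
  refine Prod.ext ?_ (funext fun l => ?_)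
  · ext1 l
    have := DFunLike.congr_fun h.1 ((Label.shiftEquiv v j).symm l)
    simpa using this
  · have := congrFun h.2 ((Label.shiftEquiv v j).symm l)
    simpa using this

/-- The symbols of the answer to the query `q` of a database that stores `C`. -/
def answerSymbol (φ : Fin μ → MvPolynomial (Fin f) F) (P : Finset (Fin μ))
    (q : SignedPerm K n μ) (C : Fin f → Fin (Fintype.card (Label K n μ)) → F) :
    AnswerIndex f K n P → F
  | Sum.inl a => C a.1 (q.row ∅ a.2.1)
  | Sum.inr a => ∑ u ∈ a.1.1, ((boundarySign a.1.1 u : ℤ) : F) *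
      (((q.2 (Label.mk (a.1.1.erase u) a.1.2) : ℤ) : F) *
        MvPolynomial.eval (fun m => C m (q.row (a.1.1.erase u) a.1.2)) (φ u))

/-- The private computation scheme: the rows are labelled, each database is queried with a uniform
signed permutation of the labels, and signed sums over sets of candidates are returned. -/
def signedSumScheme (K n : ℕ) [NeZero n] (φ : Fin μ → MvPolynomial (Fin f) F)
    (P : Finset (Fin μ)) : PCScheme F n f μ (Fintype.card (Label K n μ)) where
  Rand := SignedPerm K n μ
  randLaw := PMF.uniformOfFintype _
  Query _ := SignedPerm K n μ
  query := shiftQuery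
  len _ := Fintype.card (AnswerIndex f K n P)
  answer _ q C a := answerSymbol φ P q C ((Fintype.equivFin _).symm a)

theorem signedSumScheme_isPrivate [Fintype F] {k : ℕ} (φ : Fin μ → MvPolynomial (Fin f) F)
    (P : Finset (Fin μ)) (G : Matrix (Fin k) (Fin n) F) (ψ : Fin μ → (Fin f → F) → F) :
    (signedSumScheme K n φ P).IsPrivate G ψ := by
  refine PCScheme.isPrivate_of_map_query_eq _ G ψ fun v v' j => ?_
  exact (PMF.map_uniformOfFintype_of_bijective (shiftQuery_bijective v j)).trans
    (PMF.map_uniformOfFintype_of_bijective (shiftQuery_bijective v' j)).symm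

/-- Equal answers to the same query give equal signed sums over all sets of candidates, although
only those over the sets that meet `P` are sent. -/
theorem sum_boundary_sub_eq_zero (φ : Fin μ → MvPolynomial (Fin f) F) (P : Finset (Fin μ))
    (a : Fin μ → F) (c : Fin μ → Fin μ → F)
    (hφ : ∀ u, φ u = MvPolynomial.C (a u) + ∑ p ∈ P, c u p • φ p)
    (q : SignedPerm K n μ) (C C' : Fin f → Fin (Fintype.card (Label K n μ)) → F)
    (h : ∀ i, answerSymbol φ P q C i = answerSymbol φ P q C' i)
    (T : Finset (Fin μ)) (r : Fin μ → Fin n) (hT : T.Nonempty)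
    (hr : ∀ i, K ≤ (r i : ℕ) ↔ (i : ℕ) + 1 < T.card) :
    ∑ u ∈ T, ((boundarySign T u : ℤ) : F) * (((q.2 (Label.mk (T.erase u) r) : ℤ) : F) *
      (MvPolynomial.eval (fun m => C m (q.row (T.erase u) r)) (φ u) -
        MvPolynomial.eval (fun m => C' m (q.row (T.erase u) r)) (φ u))) = 0 := by
  obtain ⟨m, hm⟩ : ∃ m, T.card = m + 1 := ⟨T.card - 1, by have := hT.card_pos; omega⟩
  -- For a singleton the transmitted message symbols determine the value of any candidate.
  rcases Nat.eq_zero_or_pos m with rfl | hpos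
  · obtain ⟨w, rfl⟩ := Finset.card_eq_one.1 hm
    have hC : ∀ b, C b (q.row ∅ r) = C' b (q.row ∅ r) := fun b =>
      h (Sum.inl (b, ⟨r, fun i => by rw [hr i, hm]; omega⟩))
    simp [hC]
  · refine sum_boundary_eq_zero P (fun u S => ((q.2 (Label.mk S r) : ℤ) : F) *
      (MvPolynomial.eval (fun m => C m (q.row S r)) (φ u) -
        MvPolynomial.eval (fun m => C' m (q.row S r)) (φ u))) c ?_ ?_ T hm
    · intro u S
      have he : ∀ w : Fin f → F, MvPolynomial.eval w (φ u) =
          a u + ∑ p ∈ P, c u p * MvPolynomial.eval w (φ p) := by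
        intro w
        conv_lhs => rw [hφ u]
        simp [MvPolynomial.smul_eval]
      -- The constants `a u` cancel in the difference, so spanning modulo constants is enough.
      rw [he, he, add_sub_add_left_eq_sub, ← Finset.sum_sub_distrib, Finset.mul_sum]
      exact Finset.sum_congr rfl fun p _ => by ring
    · intro T' hT' hP
      have := h (Sum.inr ⟨(T', r), ⟨hP, by dsimp only; omega⟩, fun i => by
        rw [hr i, hm]; dsimp only; omega⟩)
      simp only [answerSymbol] at this
      rw [← sub_eq_zero, ← Finset.sum_sub_distrib] at this
      rw [← this]
      exact Finset.sum_congr rfl fun u _ => by ring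

/-- The answers are polynomial in the messages, but the decoding is linear in the codewords. It is
therefore applied to differences of codewords for two message tuples with the same view. -/
theorem signedSumScheme_isRecoverable [Fintype F] {k g : ℕ} (hk : 1 ≤ k)
    (hK : g * (k - 1) < K) (hKn : K ≤ n) {α : Fin n → F} (hα : Function.Injective α) {γ : Fin k → F}
    (hγ : Function.Injective γ) (φ : Fin μ → MvPolynomial (Fin f) F)
    (hdeg : ∀ v, (φ v).totalDegree ≤ g) (P : Finset (Fin μ))
    (a : Fin μ → F) (c : Fin μ → Fin μ → F)
    (hφ : ∀ u, φ u = MvPolynomial.C (a u) + ∑ p ∈ P, c u p • φ p) :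
    (signedSumScheme K n φ P).IsRecoverable (lagrangeGenerator α γ)
      (fun v w => MvPolynomial.eval w (φ v)) := by
  refine PCScheme.isRecoverable_of_determined _ _ _ fun v q q' W W' hq hA => ?_
  obtain rfl : q = q' := (shiftQuery_bijective v 0).1 (hq 0)
  let e := Fintype.equivFin (Label K n μ)
  let D : Fin μ → Label K n μ → Polynomial F := fun u l =>
    ((q.2 l : ℤ) : Polynomial F) *
      (codePoly γ W (φ u) (e (q.1 l)) - codePoly γ W' (φ u) (e (q.1 l)))
  have hD : ∀ u l, (D u l).degree < K := by
    intro u l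
    have h0 : (codePoly γ W (φ u) (e (q.1 l)) - codePoly γ W' (φ u) (e (q.1 l))).degree < K := by
      refine (Polynomial.degree_le_natDegree).trans_lt ?_
      have := (Polynomial.natDegree_sub_le_of_le
        (natDegree_codePoly_le hγ hk W (φ u) (hdeg u) (e (q.1 l)))
        (natDegree_codePoly_le hγ hk W' (φ u) (hdeg u) (e (q.1 l))))
      rw [max_self] at this
      exact_mod_cast this.trans_lt hK
    rcases Int.units_eq_one_or (q.2 l) with h | h
    · simpa [D, h] using h0
    · simp only [D, h]
      rw [Units.val_neg, Units.val_one, Int.cast_neg, Int.cast_one, neg_one_mul,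
        Polynomial.degree_neg]
      exact h0
  have hzero := desired_eq_zero hα hKn v D hD fun j T r hT hr => by
    have h := sum_boundary_sub_eq_zero φ P a c hφ (shiftQuery v q j)
      (storedData (lagrangeGenerator α γ) W j) (storedData (lagrangeGenerator α γ) W' j)
      (fun i => by
        have := congrFun (hA j) (Fintype.equivFin (AnswerIndex f K n P) i)
        simpa [PCScheme.answerVar, signedSumScheme] using this) T r hT hr
    rw [← h]
    refine Finset.sum_congr rfl fun u hu => ?_
    have hlab : ∀ i : Fin μ, K ≤ (r i : ℕ) ↔ (i : ℕ) < (T.erase u).card := by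
      intro i
      have := Finset.card_erase_add_one hu
      rw [hr i]
      omega
    simp only [D, Polynomial.eval_mul, Polynomial.eval_sub, Polynomial.eval_intCast,
      eval_codePoly_storage α γ, SignedPerm.row, shiftQuery, Label.mk_eq hlab,
      Equiv.trans_apply, Label.shiftEquiv, Equiv.coe_fn_mk, e]
    push_cast
    ring
  funext i l
  have h := hzero (q.1.symm (e.symm i))
  have h' : codePoly γ W (φ v) i = codePoly γ W' (φ v) i := by
    simp only [D, Equiv.apply_symm_apply] at h
    rw [← sub_eq_zero]
    exact (mul_eq_zero.1 h).resolve_left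
      ((q.2 (q.1.symm (e.symm i))).isUnit.map (Int.castRingHom (Polynomial F))).ne_zero
  have := congrArg (Polynomial.eval (γ l)) h'
  rwa [eval_codePoly_message hγ, eval_codePoly_message hγ] at this

theorem signedSumScheme_downloadCost (φ : Fin μ → MvPolynomial (Fin f) F) (P : Finset (Fin μ)) :
    (signedSumScheme K n φ P).downloadCost = n * Fintype.card (AnswerIndex f K n P) := by
  simp [PCScheme.downloadCost, signedSumScheme]

end Scheme

/-! ### The trivial scheme for n ≤ K -/

section DownloadAll

variable {F : Type*} {n f μ k : ℕ}

/-- The scheme that downloads all data of the first `k` databases, with one row per message. -/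
def downloadAllScheme (F : Type*) (n f μ k : ℕ) : PCScheme F n f μ 1 where
  Rand := Unit
  randLaw := PMF.pure ()
  Query _ := Unit
  query _ _ _ := ()
  len j := Fintype.card {_m : Fin f // (j : ℕ) < k}
  answer _ _ C a := C ((Fintype.equivFin _).symm a).1 0

theorem downloadAllScheme_downloadCost (hkn : k ≤ n) :
    (downloadAllScheme F n f μ k).downloadCost = k * f := by
  have h : ∀ j : Fin n, Fintype.card {_m : Fin f // (j : ℕ) < k} =
      if (j : ℕ) < k then f else 0 := by
    intro j
    rw [Fintype.card_subtype]
    split_ifs with h <;> simp [h]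
  simp only [PCScheme.downloadCost, downloadAllScheme, h]
  rw [← Finset.sum_filter, Finset.sum_const, Fin.card_filter_val_lt, min_eq_right hkn, smul_eq_mul]

theorem downloadAllScheme_isRecoverable [Field F] [Fintype F] (hkn : k ≤ n) {α : Fin n → F}
    (hα : Function.Injective α) {γ : Fin k → F} (hγ : Function.Injective γ)
    (φ : Fin μ → (Fin f → F) → F) :
    (downloadAllScheme F n f μ k).IsRecoverable (lagrangeGenerator α γ) φ := by
  refine PCScheme.isRecoverable_of_determined _ _ _ fun v q q' W W' _ hA => ?_
  have hW : W = W' := by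
    funext m i
    obtain rfl : i = 0 := Subsingleton.elim _ _
    have hcard : (Finset.univ.filter fun j : Fin n => (j : ℕ) < k).card = k := by
      rw [Fin.card_filter_val_lt, min_eq_right hkn]
    have hdeg : ∀ W : Messages F f 1 k, (Lagrange.interpolate Finset.univ γ (W m 0)).degree <
        (Finset.univ.filter fun j : Fin n => (j : ℕ) < k).card := fun W => by
      have := Lagrange.degree_interpolate_lt (s := Finset.univ) (W m 0) hγ.injOn
      rw [Finset.card_univ, Fintype.card_fin] at this
      rwa [hcard]
    have heq := Polynomial.eq_of_degrees_lt_of_eval_index_eq _ hα.injOn (hdeg W) (hdeg W')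
      fun j hj => by
        rw [← storedData_eq_eval, ← storedData_eq_eval]
        have := congrFun (hA j)
          (Fintype.equivFin {_m : Fin f // (j : ℕ) < k} ⟨m, (Finset.mem_filter.1 hj).2⟩)
        simpa [PCScheme.answerVar, downloadAllScheme] using this
    funext l
    have := congrArg (Polynomial.eval (γ l)) heq
    rwa [Lagrange.eval_interpolate_at_node _ hγ.injOn (Finset.mem_univ l),
      Lagrange.eval_interpolate_at_node _ hγ.injOn (Finset.mem_univ l)] at this
  rw [hW]

end DownloadAll

end

/-! ### Assembly and computation of the rate -/

theorem theorem5 {F : Type*} [Field F] [Fintype F] {n k f g μ : ℕ}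
    (hk : 1 ≤ k) (hkn : k ≤ n) (hf : 1 ≤ f) (hg : 1 ≤ g)
    (α : Fin n → F) (hα : Function.Injective α)
    (γ : Fin k → F) (hγ : Function.Injective γ)
    (hfμ : f ≤ μ) (hμ : μ ≤ numPolynomials (Fintype.card F) f g)
    (φ : Fin μ → MvPolynomial (Fin f) F)
    (hdeg : ∀ v, (φ v).totalDegree ≤ g)
    (hmsg : ∀ m, ∃ v, φ v = MvPolynomial.X m) :
    PCRateAchievable (lagrangeGenerator α γ)
      (fun v w => MvPolynomial.eval w (φ v))
      (ppcRate n k f g μ (minEntropy fun v w => MvPolynomial.eval w (φ v))) := by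
  have hk0 : (k : ℝ) ≠ 0 := by positivity
  have hn0 : (n : ℝ) ≠ 0 := by
    have : 0 < n := by omega
    positivity
  by_cases hn : n ≤ g * (k - 1) + 1
  · refine ⟨1, one_pos, downloadAllScheme F n f μ k,
      PCScheme.isPrivate_of_map_query_eq _ _ _ fun _ _ _ => rfl,
      downloadAllScheme_isRecoverable hkn hα hγ _, ?_⟩
    rw [PCScheme.rate, downloadAllScheme_downloadCost hkn, ppcRate, if_pos hn]
    have hf0 : (f : ℝ) ≠ 0 := by positivity
    push_cast
    field_simp
  · have : NeZero n := ⟨by omega⟩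
    obtain ⟨P, hP, a, c, hφ⟩ := exists_finset_spanning_mod_const φ hdeg
    refine ⟨Fintype.card (Label (g * (k - 1) + 1) n μ), Fintype.card_pos,
      signedSumScheme (g * (k - 1) + 1) n φ P, signedSumScheme_isPrivate φ P _ _,
      signedSumScheme_isRecoverable hk (Nat.lt_succ_self _) (by omega) hα hγ φ hdeg P a c hφ, ?_⟩
    have hPμ : P.card ≤ μ := by simpa using Finset.card_le_univ P
    have hcard := sub_mul_card_answerIndex (K := g * (k - 1) + 1) (n := n) (by omega) f P
    rw [PCScheme.rate, signedSumScheme_downloadCost, card_label (by omega), ppcRate, if_neg hn,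
      ← hP]
    generalize hKdef : g * (k - 1) + 1 = K at *
    generalize minEntropy (fun v w => MvPolynomial.eval w (φ v)) = H
    generalize Fintype.card (AnswerIndex f K n P) = d at *
    generalize P.card = s at *
    have hK0 : (K : ℝ) ≠ 0 := by
      have : 0 < K := by omega
      positivity
    have hnK : (n : ℝ) - K ≠ 0 := by
      have : (K : ℝ) < n := by exact_mod_cast (not_le.1 hn)
      linarith
    obtain ⟨m, rfl⟩ : ∃ m, μ = m + 1 := ⟨μ - 1, by omega⟩
    -- The denominator of the claimed rate is the download `d` per database, scaled by (n - K) / (K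
    -- n^μ).
    have hden : 1 - ((K : ℝ) / n) ^ s - ((s : ℝ) - f) * (1 - (K : ℝ) / n) * ((K : ℝ) / n) ^ m =
        ((n : ℝ) - K) * d / (K * (n : ℝ) ^ (m + 1)) := by
      rw [hcard, eq_div_iff (by positivity), div_pow, div_pow]
      have hs : (n : ℝ) ^ (m + 1) = (n : ℝ) ^ s * (n : ℝ) ^ (m + 1 - s) := by
        rw [← pow_add, Nat.add_sub_cancel' hPμ]
      have h1 : (K : ℝ) ^ s / (n : ℝ) ^ s * (n : ℝ) ^ (m + 1) =
          (K : ℝ) ^ s * (n : ℝ) ^ (m + 1 - s) := by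
        rw [hs]; field_simp
      have h2 : (1 - (K : ℝ) / n) * ((K : ℝ) ^ m / (n : ℝ) ^ m) * (K * (n : ℝ) ^ (m + 1)) =
          ((n : ℝ) - K) * (K : ℝ) ^ (m + 1) := by
        field_simp
        ring
      linear_combination (-(K : ℝ)) * h1 - ((s : ℝ) - f) * h2
    rw [Nat.add_sub_cancel, hden]
    -- If `d` were 0, both sides would be quotients by 0, hence equal; positivity of `d` need not be
    -- shown.
    rcases eq_or_ne (d : ℝ) 0 with hd | hd
    · simp [hd]
    · push_cast
      field_simp
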